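/- Let $\mathbb N=\{1,2,\dots\}$, and for a set $X$ let $\mathcal P_f(X)$ be the set of its nonempty finite subsets. A partial semigroup is a set $S$ with an operation $*$ defined on a subset of $S\times S$ such that $(x*y)*z=x*(y*z)$ for all $x,y,z\in S$, in the sense that if either side is defined, so is the other and they are equal; it is commutative if $x*y=y*x$ whenever $x*y$ is defined. For $s\in S$ put $\phi_S(s)=\{t\in S: s*t\text{ is defined}\}$, and for $H\subseteq S$ put $\sigma_S(H)=\bigcap_{s\in H}\phi_S(s)$. $S$ is adequate if $\sigma_S(H)\ne\emptyset$ for every $H\in\mathcal P_f(S)$. A map $h:S\to T$ of partial semigroups is a partial semigroup homomorphism if, whenever $x*y$ is defined, $h(x)*h(y)$ is defined and equals $h(x*y)$. Let $\beta S$ be the space of ultrafilters on $S$, and let $\delta S=\{p\in\beta S:\phi_S(x)\in p\text{ for all }x\in S\}$, a semigroup under $p*q=\{A\subseteq S:\{a\in S: a^{-1}A\in q\}\in p\}$, where $a^{-1}A=\{t\in\phi_S(a): a*t\in A\}$. Let $K(\delta S)$ be its smallest two-sided ideal. A set $C\subseteq S$ is central in $S$ if $C\in p$ for some idempotent $p\in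 K(\delta S)$. A sequence $f:\mathbb N\to S$ is adequate if $\prod_{n\in F}f(n)$ (taken in increasing order of indices) is defined for every $F\in\mathcal P_f(\mathbb N)$, and for every $K\in\mathcal P_f(S)$ there is $m\in\mathbb N$ such that $\prod_{n\in F}f(n)\in\sigma_S(K)$ for every $F\in\mathcal P_f(\{n\in\mathbb N:n\ge m\})$. Let $\mathcal T_S$ be the set of adequate sequences in $S$. A set $A\subseteq S$ is a $J_\delta$-set if for all $F\in\mathcal P_f(\mathcal T_S)$ and $W\in\mathcal P_f(S)$ there are $a\in\sigma_S(W)$ and $H\in\mathcal P_f(\mathbb N)$ such that for every $f\in F$ one has $\prod_{t\in H}f(t)\in\sigma_S(\{w*a:w\in W\})$ and $a*\prod_{t\in H}f(t)\in A$. Let $J_\delta(S)$ be the set of $p\in\delta S$ all of whose members are $J_\delta$-sets. A set $A\subseteq S$ is a C-set in $S$ if there are functions $\alpha:\mathcal P_f(\mathcal T_S)\to S$ and $H:\mathcal P_f(\mathcal T_S)\to\mathcal P_f(\mathbb N)$ such that (1) $\max H(F)<\min H(G)$ whenever $F\subsetneq G$, and (2) whenever $m\in\mathbb N$, $G_1\subsetneq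 G_2\subsetneq\dots\subsetneq G_m$ in $\mathcal P_f(\mathcal T_S)$ and $f_i\in G_i$ for $1\le i\le m$, the product $\prod_{i=1}^m\bigl(\alpha(G_i)*\prod_{t\in H(G_i)}f_i(t)\bigr)$ is defined and belongs to $A$. **Corollary.** Let $S$ and $T$ be adequate commutative partial semigroups, let $h:S\to T$ be a surjective partial semigroup homomorphism, and let $\tilde h:\beta S\to\beta T$ be its continuous extension. Assume that $\tilde h(\delta S)=\delta T$. Let $A\subseteq T$ be a set that is not central in $T$, and assume that there is an idempotent $p\in\delta T$ with $A\in p$ and $p\in\tilde h(J_\delta(S))$. Then $h^{-1}(A)$ is a C-set in $S$ and is not central in $S$. -/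

import Mathlib

universe u v

/-- A partial semigroup: a partially defined operation (`op x y = none` means that the product of
`x` and `y` is not defined) such that `(x * y) * z = x * (y * z)`, in the sense that if either side
is defined, then so is the other and they are equal. -/
class PartialSemigroup (S : Type u) where
  /-- The partial operation. -/
  op : S → S → Option S
  assoc : ∀ x y z : S,
    ((op x y).bind fun w => op w z) = ((op y z).bind fun w => op x w)

namespace PartialSemigroup

/-- `x * y = y * x` whenever `x * y` is defined. -/
def IsCommutative (S : Type u) [PartialSemigroup S] : Prop :=
  ∀ x y z : S, op x y = some z → op y x = some z

/-- `φ(s)`: the set of all `t` such that `s * t` is defined. -/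
def phi {S : Type u} [PartialSemigroup S] (s : S) : Set S :=
  {t | ∃ z, op s t = some z}

/-- `σ(H)`: the intersection of the sets `φ(s)` over `s ∈ H`. -/
def sigma {S : Type u} [PartialSemigroup S] (H : Set S) : Set S :=
  ⋂ s ∈ H, phi s

/-- `P_f(X)`: the nonempty finite subsets of `X`. -/
abbrev FinPow (X : Type u) : Type u := {F : Finset X // F.Nonempty}

/-- `S` is adequate: `σ(H)` is nonempty for every nonempty finite `H ⊆ S`. -/
def IsAdequate (S : Type u) [PartialSemigroup S] : Prop :=
  ∀ H : FinPow S, (sigma (H.1 : Set S)).Nonempty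

/-- The partial operation on possibly undefined expressions: the product is defined if and only
if both factors are defined and their product is. -/
def optMul {S : Type u} [PartialSemigroup S] (x y : Option S) : Option S :=
  x.bind fun a => y.bind fun b => op a b

/-- The product, from left to right, of a nonempty list of possibly undefined expressions
(the empty product is undefined). -/
def listProd {S : Type u} [PartialSemigroup S] : List (Option S) → Option S
  | [] => none
  | [x] => x
  | x :: y :: l => optMul x (listProd (y :: l))

/-- The product of `f n` over `n ∈ F`, in increasing order of indices. -/
def finProd {S : Type u} [PartialSemigroup S] (f : ℕ → S) (F : Finset ℕ) : Option S :=
  listProd ((F.sort (· ≤ ·)).map fun n => some (f n))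

/-- `FP(⟨f n⟩, n ≥ m)`: the set of all products of `f n` over `n ∈ F`, for `F` a nonempty finite
set of indices that are at least `m`. -/
def finiteProducts {S : Type u} [PartialSemigroup S] (f : ℕ → S) (m : ℕ) : Set S :=
  {x | ∃ F : FinPow ℕ, (∀ n ∈ F.1, m ≤ n) ∧ finProd f F.1 = some x}

/-- Adequate sequences. -/
def IsAdequateSeq {S : Type u} [PartialSemigroup S] (f : ℕ → S) : Prop :=
  (∀ F : FinPow ℕ, ∃ x, finProd f F.1 = some x) ∧
    ∀ K : FinPow S, ∃ m : ℕ, finiteProducts f m ⊆ sigma (K.1 : Set S)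

/-- The set of all adequate sequences in `S`, as a type. -/
abbrev AdequateSeq (S : Type u) [PartialSemigroup S] : Type u :=
  {f : ℕ → S // IsAdequateSeq f}

/-- `A` is a C-set. -/
def IsCSet {S : Type u} [PartialSemigroup S] (A : Set S) : Prop :=
  ∃ (α : FinPow (AdequateSeq S) → S) (H : FinPow (AdequateSeq S) → FinPow ℕ),
    (∀ F G : FinPow (AdequateSeq S), F.1 ⊂ G.1 →
      (H F).1.max' (H F).2 < (H G).1.min' (H G).2) ∧
    ∀ (m : ℕ), 1 ≤ m → ∀ (G : Fin m → FinPow (AdequateSeq S)) (f : Fin m → AdequateSeq S),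
      (∀ i j : Fin m, i < j → (G i).1 ⊂ (G j).1) → (∀ i, f i ∈ (G i).1) →
      ∃ x ∈ A, listProd (List.ofFn fun i =>
        optMul (some (α (G i))) (finProd (f i).1 (H (G i)).1)) = some x

/-- `W * a`: the set of all products `w * a`, for `w ∈ W`, that are defined. -/
def mulRight {S : Type u} [PartialSemigroup S] (W : Set S) (a : S) : Set S :=
  {x | ∃ w ∈ W, op w a = some x}

/-- `A` is a `J_δ`-set. -/
def IsJdeltaSet {S : Type u} [PartialSemigroup S] (A : Set S) : Prop :=
  ∀ (F : FinPow (AdequateSeq S)) (W : FinPow S),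
    ∃ a ∈ sigma (W.1 : Set S), ∃ H : FinPow ℕ, ∀ f ∈ F.1,
      (∃ y ∈ sigma (mulRight (W.1 : Set S) a), finProd f.1 H.1 = some y) ∧
      ∃ x ∈ A, optMul (some a) (finProd f.1 H.1) = some x

/-- `δS`, as a subset of `βS` (the space of ultrafilters on `S`): the intersection of the closures
in `βS` of the sets `φ(x)`; the closure of `B ⊆ S` consists of the ultrafilters containing `B`. -/
def delta (S : Type u) [PartialSemigroup S] : Set (Ultrafilter S) :=
  {p | ∀ x : S, phi x ∈ p}

/-- `J_δ(S)`: the points of `δS` all of whose members are `J_δ`-sets. -/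
def Jdelta (S : Type u) [PartialSemigroup S] : Set (Ultrafilter S) :=
  {p | p ∈ delta S ∧ ∀ A ∈ p, IsJdeltaSet A}

/-- `s⁻¹A`: the set of all `t ∈ φ(s)` with `s * t ∈ A`. -/
def invMul {S : Type u} [PartialSemigroup S] (s : S) (A : Set S) : Set S :=
  {t | ∃ z ∈ A, op s t = some z}

theorem invMul_inter {S : Type u} [PartialSemigroup S] (s : S) (A B : Set S) :
    invMul s (A ∩ B) = invMul s A ∩ invMul s B := by
  ext t
  constructor
  · rintro ⟨z, ⟨hA, hB⟩, h⟩
    exact ⟨⟨z, hA, h⟩, ⟨z, hB, h⟩⟩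
  · rintro ⟨⟨z, hA, h⟩, ⟨w, hB, h2⟩⟩
    have e : z = w := by rw [h] at h2; exact Option.some.inj h2
    subst e
    exact ⟨z, ⟨hA, hB⟩, h⟩

theorem invMul_mono {S : Type u} [PartialSemigroup S] (s : S) {A B : Set S} (h : A ⊆ B) :
    invMul s A ⊆ invMul s B :=
  fun _ ⟨z, hz, e⟩ => ⟨z, h hz, e⟩

theorem invMul_compl_mem_iff {S : Type u} [PartialSemigroup S] {q : Ultrafilter S}
    (hq : q ∈ delta S) (s : S) (A : Set S) : invMul s Aᶜ ∈ q ↔ invMul s A ∉ q := by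
  rw [← Ultrafilter.compl_mem_iff_notMem]
  constructor
  · intro h
    filter_upwards [h]
    rintro t ⟨z, hz, e⟩ ⟨w, hw, e2⟩
    rw [e] at e2
    exact hz (Option.some.inj e2 ▸ hw)
  · intro h
    filter_upwards [h, hq s]
    rintro t ht ⟨z, e⟩
    exact ⟨z, fun hz => ht ⟨z, hz, e⟩, e⟩

/-- The ultrafilter `p * q`, for `p ∈ βS` and `q ∈ δS`: one has `A ∈ p * q` if and only if
`{a | a⁻¹A ∈ q} ∈ p`. -/
def ultraMul {S : Type u} [PartialSemigroup S] (p : Ultrafilter S) (q : delta S) :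
    Ultrafilter S :=
  Ultrafilter.ofComplNotMemIff
    { sets := {A | {a | invMul a A ∈ q.1} ∈ p}
      univ_sets := by
        refine Filter.mem_of_superset Filter.univ_mem fun a _ => ?_
        refine Filter.mem_of_superset (q.2 a) ?_
        rintro t ⟨z, e⟩
        exact ⟨z, trivial, e⟩
      sets_of_superset := by
        intro A B hA h
        exact Filter.mem_of_superset hA fun a ha =>
          Filter.mem_of_superset ha (invMul_mono a h)
      inter_sets := by
        intro A B hA hB
        filter_upwards [hA, hB] with a ha hb
        rw [invMul_inter]
        exact Filter.inter_mem ha hb }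
    (by
      intro A
      change {a | invMul a Aᶜ ∈ q.1} ∉ p ↔ {a | invMul a A ∈ q.1} ∈ p
      have e : {a | invMul a Aᶜ ∈ q.1} = {a | invMul a A ∈ q.1}ᶜ := by
        ext a
        exact invMul_compl_mem_iff q.2 a A
      rw [e, Ultrafilter.compl_notMem_iff])

theorem mem_ultraMul {S : Type u} [PartialSemigroup S] (p : Ultrafilter S) (q : delta S)
    (A : Set S) : A ∈ ultraMul p q ↔ {a | invMul a A ∈ q.1} ∈ p :=
  Iff.rfl

theorem invMul_invMul {S : Type u} [PartialSemigroup S] {a b c : S} (h : op a b = some c)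
    (A : Set S) : invMul b (invMul a A) = invMul c A := by
  ext t
  have e := assoc a b t
  rw [h, Option.bind_some] at e
  constructor
  · rintro ⟨z, ⟨w, hw, h2⟩, h1⟩
    refine ⟨w, hw, ?_⟩
    rw [e, h1, Option.bind_some, h2]
  · rintro ⟨w, hw, h1⟩
    rw [h1] at e
    obtain ⟨z, h2, h3⟩ := Option.bind_eq_some_iff.1 e.symm
    exact ⟨z, ⟨w, hw, h3⟩, h2⟩

theorem ultraMul_mem_delta {S : Type u} [PartialSemigroup S] (p q : delta S) :
    ultraMul p.1 q ∈ delta S := by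
  intro x
  rw [mem_ultraMul]
  filter_upwards [p.2 x]
  rintro b ⟨c, hc⟩
  filter_upwards [q.2 c]
  rintro t ⟨z, hz⟩
  have e := assoc x b t
  rw [hc, Option.bind_some, hz] at e
  obtain ⟨w, h2, h3⟩ := Option.bind_eq_some_iff.1 e.symm
  exact ⟨w, ⟨z, h3⟩, h2⟩

/-- The operation of `δS`, which makes it a semigroup. -/
instance deltaSemigroup (S : Type u) [PartialSemigroup S] : Semigroup (delta S) where
  mul p q := ⟨ultraMul p.1 q, ultraMul_mem_delta p q⟩
  mul_assoc p q r := by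
    apply Subtype.ext
    apply Ultrafilter.ext
    intro A
    change {b | invMul b A ∈ r.1} ∈ ultraMul p.1 q ↔
      {a | {b | invMul b (invMul a A) ∈ r.1} ∈ q.1} ∈ p.1
    rw [mem_ultraMul]
    have key : ∀ a, invMul a {b | invMul b A ∈ r.1} ∈ q.1 ↔
        {b | invMul b (invMul a A) ∈ r.1} ∈ q.1 := by
      intro a
      constructor
      · intro h
        filter_upwards [h]
        rintro b ⟨c, hc, e⟩
        rw [invMul_invMul e]
        exact hc
      · intro h
        filter_upwards [h, q.2 a]
        rintro b hb ⟨c, e⟩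
        refine ⟨c, ?_, e⟩
        change invMul c A ∈ r.1
        rw [← invMul_invMul e]
        exact hb
    simp only [key]

/-- A two-sided ideal of a semigroup: a nonempty subset closed under multiplication, on either
side, by arbitrary elements. -/
def IsTwoSidedIdeal {M : Type u} [Semigroup M] (I : Set M) : Prop :=
  I.Nonempty ∧ ∀ x ∈ I, ∀ y : M, y * x ∈ I ∧ x * y ∈ I

/-- `K(M)`: the smallest two-sided ideal of `M`, as the intersection of all two-sided ideals. -/
def smallestIdeal (M : Type u) [Semigroup M] : Set M :=
  ⋂₀ {I | IsTwoSidedIdeal I}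

/-- `C` is central: it is a member of some idempotent in `K(δS)`. -/
def IsCentral {S : Type u} [PartialSemigroup S] (C : Set S) : Prop :=
  ∃ p : delta S, IsIdempotentElem p ∧ p ∈ smallestIdeal (delta S) ∧ C ∈ p.1

/-- Partial semigroup homomorphisms: whenever `x * y` is defined, so is `h x * h y`, and it is
equal to `h (x * y)`. -/
def IsPartialHom {S : Type u} {T : Type v} [PartialSemigroup S] [PartialSemigroup T]
    (h : S → T) : Prop :=
  ∀ x y z : S, op x y = some z → op (h x) (h y) = some (h z)

/-- The continuous extension `βS → βT` of `h : S → T`. -/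
noncomputable def betaExtend {S : Type u} {T : Type v} (h : S → T) :
    Ultrafilter S → Ultrafilter T :=
  Ultrafilter.extend fun s => (pure (h s) : Ultrafilter T)

end PartialSemigroup

/-! For the C-set claim, consider the points of `Jdelta S` lying over the idempotent `p`. They form
a nonempty compact subsemigroup of `delta S`: `Jdelta S` is closed, and commutativity makes it a
right ideal (`mul_mem_Jdelta`). Ellis' theorem gives an idempotent `r` there, and `h ⁻¹' A ∈ r`
because `r` lies over `p`. Every member of an idempotent of `Jdelta S` is a C-set, by recursion on
finite sets of sequences (`isCSet_of_mem_idempotent`). For non-centrality, the extension of `h` is a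
surjective homomorphism `delta S → delta T`, so it maps smallest ideal into smallest ideal; an
idempotent witnessing that `h ⁻¹' A` is central would push forward to one for `A`. -/

namespace PartialSemigroup

open Filter Topology

/-! ### Extending homomorphisms to ultrafilters -/

section Extension

variable {S : Type u} {T : Type v}

theorem betaExtend_eq_map (h : S → T) (p : Ultrafilter S) : betaExtend h p = p.map h := by
  unfold betaExtend
  rw [ultrafilter_extend_eq_iff]
  have e : p.map (fun s => (pure (h s) : Ultrafilter T)) = (p.map h).map pure :=
    (Ultrafilter.map_map p h pure).symm
  rw [e]
  exact Ultrafilter.tendsto_pure_self _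

theorem mem_betaExtend (h : S → T) (p : Ultrafilter S) (A : Set T) :
    A ∈ betaExtend h p ↔ h ⁻¹' A ∈ p := by
  rw [betaExtend_eq_map, Ultrafilter.mem_map]

theorem continuous_betaExtend (h : S → T) : Continuous (betaExtend h) :=
  continuous_ultrafilter_extend _

variable [PartialSemigroup S] [PartialSemigroup T]

/-- The product `h a * h t` can be defined when `a * t` is not; membership of `q` in `delta S` makes
`a * t` defined for `q`-almost all `t`. -/
theorem IsPartialHom.preimage_invMul_mem_iff {h : S → T} (hh : IsPartialHom h) {q : Ultrafilter S}
    (hq : q ∈ delta S) (a : S) (A : Set T) :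
    h ⁻¹' invMul (h a) A ∈ q ↔ invMul a (h ⁻¹' A) ∈ q := by
  constructor
  · intro H
    filter_upwards [H, hq a]
    rintro t ⟨z, hz, e⟩ ⟨w, e'⟩
    refine ⟨w, ?_, e'⟩
    rw [hh _ _ _ e', Option.some_inj] at e
    exact Set.mem_preimage.2 (by rwa [e])
  · intro H
    filter_upwards [H]
    rintro t ⟨w, hw, e⟩
    exact ⟨h w, hw, hh _ _ _ e⟩

theorem IsPartialHom.betaExtend_mul {h : S → T} (hh : IsPartialHom h) (p q : delta S)
    (p' q' : delta T) (hp : betaExtend h p.1 = p'.1) (hq : betaExtend h q.1 = q'.1) :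
    betaExtend h (p * q).1 = (p' * q').1 := by
  ext A
  change A ∈ betaExtend h (ultraMul p.1 q) ↔ A ∈ ultraMul p'.1 q'
  rw [mem_betaExtend, mem_ultraMul, mem_ultraMul, ← hp, ← hq, mem_betaExtend]
  simp only [mem_betaExtend, Set.preimage_ofPred_eq, hh.preimage_invMul_mem_iff q.2]

/-- The map `δS → δT` induced by a homomorphism `h` whose extension maps `δS` into `δT`. -/
noncomputable def IsPartialHom.deltaMap {h : S → T} (hh : IsPartialHom h)
    (hd : Set.MapsTo (betaExtend h) (delta S) (delta T)) : delta S →ₙ* delta T where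
  toFun p := ⟨betaExtend h p.1, hd p.2⟩
  map_mul' _ _ := Subtype.ext (hh.betaExtend_mul _ _ _ _ rfl rfl)

end Extension

/-- The preimage of a two-sided ideal is a two-sided ideal; surjectivity makes it nonempty. -/
theorem map_mem_smallestIdeal {M : Type u} {N : Type v} [Semigroup M] [Semigroup N] (g : M →ₙ* N)
    (hg : Function.Surjective g) {x : M} (hx : x ∈ smallestIdeal M) : g x ∈ smallestIdeal N := by
  rintro I ⟨⟨y, hy⟩, hI⟩
  obtain ⟨z, rfl⟩ := hg y
  refine hx (g ⁻¹' I) ⟨⟨z, hy⟩, fun a ha b => ?_⟩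
  simpa only [Set.mem_preimage, map_mul] using hI _ ha (g b)

/-! ### Compactness of `delta S` and the right ideal `Jdelta S` -/

section Delta

variable {S : Type u} [PartialSemigroup S]

theorem isClosed_delta : IsClosed (delta S) := by
  have e : delta S = ⋂ x : S, {p | phi x ∈ p} := by
    ext p
    simp [delta]
  rw [e]
  exact isClosed_iInter fun x => ultrafilter_isClosed_basic _

instance : CompactSpace (delta S) :=
  isCompact_iff_compactSpace.1 isClosed_delta.isCompact

theorem continuous_mul_right_delta (q : delta S) : Continuous fun p : delta S => p * q := by
  refine Continuous.subtype_mk (f := fun p : delta S => ultraMul p.1 q) ?_ _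
  refine (ultrafilterBasis_is_basis).continuous_iff.2 ?_
  rintro _ ⟨A, rfl⟩
  exact (ultrafilter_isOpen_basic {a | invMul a A ∈ q.1}).preimage continuous_subtype_val

theorem isClosed_Jdelta : IsClosed (Jdelta S) := by
  have e : Jdelta S = delta S ∩ ⋂ A ∈ {A : Set S | ¬ IsJdeltaSet A}, {p | Aᶜ ∈ p} := by
    ext p
    simp only [Jdelta, Set.mem_inter_iff, Set.mem_iInter, Set.mem_ofPred_eq,
      Ultrafilter.compl_mem_iff_notMem]
    exact and_congr_right fun _ => forall_congr' fun A => not_imp_not.symm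
  rw [e]
  exact isClosed_delta.inter
    (isClosed_biInter fun A _ => ultrafilter_isClosed_basic _)

theorem mem_sigma {H : Set S} {x : S} : x ∈ sigma H ↔ ∀ s ∈ H, ∃ z, op s x = some z := by
  simp [sigma, phi]

theorem op_op {a b c x y : S} (h₁ : op a b = some x) (h₂ : op x c = some y) :
    ∃ z, op b c = some z ∧ op a z = some y := by
  have e := assoc a b c
  rw [h₁, Option.bind_some, h₂] at e
  exact Option.bind_eq_some_iff.1 e.symm

theorem op_op' {a b c x y : S} (h₁ : op b c = some x) (h₂ : op a x = some y) :
    ∃ z, op a b = some z ∧ op z c = some y := by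
  have e := assoc a b c
  rw [h₁, Option.bind_some, h₂] at e
  exact Option.bind_eq_some_iff.1 e

/-- Take `a` and `H` for the `J_δ`-set of all `x` with `x⁻¹A ∈ q`. Only finitely many `q`-large
conditions are then imposed on `b`, so some `b` meets them all, and `a * b` works with the same `H`:
by commutativity `(a * y) * b = a * (y * b) = (a * b) * y`. -/
theorem isJdeltaSet_of_mem_ultraMul (hc : IsCommutative S) {p : Ultrafilter S}
    (hp : p ∈ Jdelta S) (q : delta S) {A : Set S} (hA : A ∈ ultraMul p q) : IsJdeltaSet A := by
  intro F W
  obtain ⟨a, ha, H, hH⟩ := hp.2 _ ((mem_ultraMul p q A).1 hA) F W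
  rw [mem_sigma] at ha
  have hb : ∀ᶠ b in (q.1 : Filter S), (∀ w ∈ W.1, ∃ wa, op w a = some wa ∧
      ∃ z, op wa b = some z ∧ ∀ f ∈ F.1, ∀ y, finProd f.1 H.1 = some y →
        ∃ v, op wa y = some v ∧ ∃ u, op v b = some u) ∧
      ∀ f ∈ F.1, ∃ y x, finProd f.1 H.1 = some y ∧ op a y = some x ∧ b ∈ invMul x A := by
    refine Filter.Eventually.and ?_ ?_
    · rw [Filter.eventually_all_finset]
      intro w hw
      obtain ⟨wa, hwa⟩ := ha w hw
      have h₁ : ∀ᶠ b in (q.1 : Filter S), ∀ f ∈ F.1, ∀ y, finProd f.1 H.1 = some y →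
          ∃ v, op wa y = some v ∧ ∃ u, op v b = some u := by
        rw [Filter.eventually_all_finset]
        intro f hf
        obtain ⟨⟨y, hy, hy'⟩, -⟩ := hH f hf
        obtain ⟨v, hv⟩ := mem_sigma.1 hy wa ⟨w, hw, hwa⟩
        filter_upwards [q.2 v] with b hb y₁ hy₁
        obtain rfl : y = y₁ := Option.some.inj (hy'.symm.trans hy₁)
        exact ⟨v, hv, hb⟩
      filter_upwards [h₁, q.2 wa] with b hb ⟨z, hz⟩
      exact ⟨wa, hwa, z, hz, hb⟩
    · rw [Filter.eventually_all_finset]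
      intro f hf
      obtain ⟨⟨y, -, hy⟩, x, hx, hxy⟩ := hH f hf
      rw [hy] at hxy
      filter_upwards [hx] with b hb
      exact ⟨y, x, hy, hxy, hb⟩
  obtain ⟨b, hb₁, hb₂⟩ := hb.exists
  -- That `a * b` is defined is read off from `(w₀ * a) * b`.
  obtain ⟨w₀, hw₀⟩ := W.2
  obtain ⟨wa₀, hwa₀, z₀, hz₀, -⟩ := hb₁ w₀ hw₀
  obtain ⟨ab, hab, -⟩ := op_op hwa₀ hz₀
  refine ⟨ab, mem_sigma.2 fun w hw => ?_, H, fun f hf => ?_⟩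
  · obtain ⟨wa, hwa, z, hz, -⟩ := hb₁ w hw
    obtain ⟨c, hab', hc'⟩ := op_op hwa hz
    obtain rfl : c = ab := Option.some.inj (hab'.symm.trans hab)
    exact ⟨z, hc'⟩
  obtain ⟨y, x, hy, hx, t, ht, hxb⟩ := hb₂ f hf
  obtain ⟨yb, hyb, hayb⟩ := op_op hx hxb
  obtain ⟨d, hd, hdy⟩ := op_op' (hc _ _ _ hyb) hayb
  obtain rfl : d = ab := Option.some.inj (hd.symm.trans hab)
  refine ⟨⟨y, mem_sigma.2 ?_, hy⟩, t, ht, ?_⟩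
  · rintro e ⟨w, hw, he⟩
    obtain ⟨wa, hwa, z, hz, h₃⟩ := hb₁ w hw
    obtain ⟨v, hv, u, hu⟩ := h₃ f hf y hy
    obtain ⟨c, hab', hc'⟩ := op_op hwa hz
    obtain rfl : c = d := Option.some.inj (hab'.symm.trans hab)
    obtain rfl : z = e := Option.some.inj (hc'.symm.trans he)
    obtain ⟨yb', hyb', hu'⟩ := op_op hv hu
    obtain ⟨z', hz', hzy⟩ := op_op' (hc _ _ _ hyb') hu'
    obtain rfl : z' = z := Option.some.inj (hz'.symm.trans hz)
    exact ⟨u, hzy⟩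
  · rw [hy]
    exact hdy

theorem mul_mem_Jdelta (hc : IsCommutative S) (p q : delta S) (hp : p.1 ∈ Jdelta S) :
    (p * q).1 ∈ Jdelta S :=
  ⟨(p * q).2, fun _ hA => isJdeltaSet_of_mem_ultraMul hc hp q hA⟩

theorem exists_isIdempotentElem_of_fiber {T : Type v} [PartialSemigroup T] {h : S → T}
    (hc : IsCommutative S) (hh : IsPartialHom h) {p : delta T} (hp : IsIdempotentElem p)
    (hJ : p.1 ∈ betaExtend h '' Jdelta S) :
    ∃ r : delta S, IsIdempotentElem r ∧ r.1 ∈ Jdelta S ∧ betaExtend h r.1 = p.1 := by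
  let C : Set (delta S) := {r | r.1 ∈ Jdelta S ∧ betaExtend h r.1 = p.1}
  have hC : IsClosed C :=
    (isClosed_Jdelta.preimage continuous_subtype_val).inter
      (isClosed_singleton.preimage ((continuous_betaExtend h).comp continuous_subtype_val))
  obtain ⟨q, hq, hqp⟩ := hJ
  obtain ⟨r, hr, hrr⟩ := exists_idempotent_in_compact_subsemigroup
    (fun r : delta S => continuous_mul_right_delta r) C ⟨⟨q, hq.1⟩, hq, hqp⟩ hC.isCompact
    (by
      rintro x ⟨hx, hxp⟩ y ⟨hy, hyp⟩
      refine ⟨mul_mem_Jdelta hc x y hx, ?_⟩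
      rw [hh.betaExtend_mul x y p p hxp hyp, hp.eq])
  exact ⟨r, hrr, hr⟩

end Delta

/-! ### Shifting adequate sequences -/

section Shift

variable {S : Type u} [PartialSemigroup S]

theorem finProd_shift (f : ℕ → S) (k : ℕ) (F : Finset ℕ) :
    finProd (fun n => f (n + k)) F = finProd f (F.map (addRightEmbedding k)) := by
  unfold finProd
  congr 1
  have e := Finset.map_sort (r := (· ≤ ·)) (r' := (· ≤ ·)) (addRightEmbedding k) F
    (fun a _ b _ => by simp)
  rw [← e, List.map_map]
  rfl

theorem IsAdequateSeq.shift {f : ℕ → S} (hf : IsAdequateSeq f) (k : ℕ) :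
    IsAdequateSeq fun n => f (n + k) := by
  refine ⟨fun F => ?_, fun K => ?_⟩
  · rw [finProd_shift]
    exact hf.1 ⟨_, F.2.map⟩
  · obtain ⟨m, hm⟩ := hf.2 K
    refine ⟨m, ?_⟩
    rintro x ⟨F, hF, hx⟩
    rw [finProd_shift] at hx
    refine hm ⟨⟨_, F.2.map⟩, fun n hn => ?_, hx⟩
    obtain ⟨i, hi, rfl⟩ := Finset.mem_map.1 hn
    exact (hF i hi).trans (Nat.le_add_right i k)

/-- In the definition of a `J_δ`-set, the index set may be taken beyond any given bound. -/
theorem IsJdeltaSet.exists_lt {A : Set S} (hA : IsJdeltaSet A) (F : FinPow (AdequateSeq S))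
    (m : ℕ) : ∃ (a : S) (H : FinPow ℕ), (∀ n ∈ H.1, m < n) ∧
      ∀ f ∈ F.1, ∃ x ∈ A, optMul (some a) (finProd f.1 H.1) = some x := by
  classical
  let s : AdequateSeq S → AdequateSeq S := fun f => ⟨_, f.2.shift (m + 1)⟩
  -- `W` must be nonempty, but its conditions are discarded; any element of `S` serves.
  obtain ⟨f₀, -⟩ := F.2
  obtain ⟨a, -, H, hH⟩ := hA ⟨F.1.image s, F.2.image s⟩ ⟨{f₀.1 0}, Finset.singleton_nonempty _⟩
  refine ⟨a, ⟨_, H.2.map (f := addRightEmbedding (m + 1))⟩, fun n hn => ?_, fun f hf => ?_⟩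
  · obtain ⟨i, -, rfl⟩ := Finset.mem_map.1 hn
    simp only [addRightEmbedding_apply]
    omega
  · have := (hH (s f) (Finset.mem_image_of_mem s hf)).2
    rwa [finProd_shift] at this

end Shift

/-! ### Members of idempotents in `Jdelta S` are C-sets -/

section CSet

variable {S : Type u} [PartialSemigroup S]

theorem optMul_assoc (x y z : Option S) : optMul (optMul x y) z = optMul x (optMul y z) := by
  rcases x with _ | x
  · rfl
  rcases y with _ | y
  · rfl
  rcases z with _ | z
  · cases h : op x y <;> simp [optMul]
  · simpa [optMul] using assoc x y z

theorem listProd_append_singleton (l : List (Option S)) (hl : l ≠ []) (z : Option S) :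
    listProd (l ++ [z]) = optMul (listProd l) z := by
  induction l with
  | nil => exact absurd rfl hl
  | cons x l ih =>
    cases l with
    | nil => rfl
    | cons y l =>
      have e := ih (List.cons_ne_nil _ _)
      simp only [List.cons_append] at e ⊢
      simp only [listProd]
      rw [e, optMul_assoc]

/-- The set of those `x ∈ B` with `x⁻¹B ∈ r`. -/
def star (r : delta S) (B : Set S) : Set S :=
  {x | x ∈ B ∧ invMul x B ∈ r.1}

theorem star_mem {r : delta S} (hr : IsIdempotentElem r) {B : Set S} (hB : B ∈ r.1) :
    star r B ∈ r.1 := by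
  have h : B ∈ (r * r).1 := by rwa [hr.eq]
  exact Filter.inter_mem hB ((mem_ultraMul r.1 r B).1 h)

/-- Apply `star_mem` to `x⁻¹B` and use `t⁻¹(x⁻¹B) = (x * t)⁻¹B`. -/
theorem invMul_star_mem {r : delta S} (hr : IsIdempotentElem r) {B : Set S} {x : S}
    (hx : x ∈ star r B) : invMul x (star r B) ∈ r.1 := by
  filter_upwards [star_mem hr hx.2]
  rintro t ⟨⟨z, hz, e⟩, ht⟩
  rw [invMul_invMul e] at ht
  exact ⟨z, ⟨hz, ht⟩, e⟩

/-- A well-founded choice principle: if values for the predecessors of `x` can always be completed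
by a value for `x`, then all values can be chosen simultaneously. -/
theorem exists_wellFounded_choice {X : Type*} {Y : Type*} {r : X → X → Prop}
    (hr : WellFounded r) (R : (x : X) → (∀ y, r y x → Y) → Y → Prop)
    (h : ∀ x prev, ∃ y, R x prev y) : ∃ Φ : X → Y, ∀ x, R x (fun y _ => Φ y) (Φ x) := by
  choose g hg using h
  refine ⟨hr.fix g, fun x => ?_⟩
  rw [hr.fix_eq g x]
  exact hg x _

/-- The recursion is along strict inclusion. Besides `α F` and `H F` it carries a finite set `P ⊆
star r B` containing all products along chains that end at `F`. If `N` is the union of the earlier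
such sets, `star r B` intersected with all `x⁻¹(star r B)`, `x ∈ N`, lies in `r`, hence is a
`J_δ`-set; it supplies the next factors. -/
theorem isCSet_of_mem_idempotent {r : delta S} (hr : IsIdempotentElem r) (hJ : r.1 ∈ Jdelta S)
    {B : Set S} (hB : B ∈ r.1) : IsCSet B := by
  classical
  let X := FinPow (AdequateSeq S)
  let Y := S × FinPow ℕ × {P : Set S // P.Finite ∧ P ⊆ star r B}
  have hwf : WellFounded fun G F : X => G.1 ⊂ F.1 :=
    InvImage.wf (fun F : X => F.1) wellFounded_lt
  obtain ⟨Φ, hΦ⟩ := exists_wellFounded_choice (Y := Y) hwf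
    (fun F prev y =>
      (∀ G hG, (prev G hG).2.1.1.max' (prev G hG).2.1.2 < y.2.1.1.min' y.2.1.2) ∧
      ∀ f ∈ F.1, ∃ z ∈ y.2.2.1, optMul (some y.1) (finProd f.1 y.2.1.1) = some z ∧
        ∀ G hG, ∀ x ∈ (prev G hG).2.2.1, ∃ w ∈ y.2.2.1, op x z = some w) (by
    intro F prev
    -- Finiteness of the set of predecessors bounds the earlier index sets and makes `N` finite.
    have hfin : Finite {G : X // G.1 ⊂ F.1} := by
      refine Finite.of_injective
        (fun G : {G : X // G.1 ⊂ F.1} => (⟨G.1.1, Finset.mem_powerset.2 G.2.1⟩ : F.1.powerset)) ?_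
      intro G G' e
      have e' : G.1.1 = G'.1.1 := congrArg (fun x : F.1.powerset => x.1) e
      exact Subtype.ext (Subtype.ext e')
    obtain ⟨m, hm⟩ := (Set.finite_range fun G : {G : X // G.1 ⊂ F.1} =>
      (prev G.1 G.2).2.1.1.max' (prev G.1 G.2).2.1.2).bddAbove
    let N : Set S := ⋃ G : {G : X // G.1 ⊂ F.1}, (prev G.1 G.2).2.2.1
    have hN : N.Finite := Set.finite_iUnion fun G => (prev G.1 G.2).2.2.2.1
    have hNs : N ⊆ star r B := Set.iUnion_subset fun G => (prev G.1 G.2).2.2.2.2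
    have hD : star r B ∩ ⋂ x ∈ N, invMul x (star r B) ∈ r.1 :=
      Filter.inter_mem (star_mem hr hB)
        ((Filter.biInter_mem hN).2 fun x hx => invMul_star_mem hr (hNs hx))
    obtain ⟨a, H, hH, hF⟩ := (hJ.2 _ hD).exists_lt F m
    have : Nonempty S := ⟨a⟩
    choose! z hz e using hF
    have hz' : ∀ f ∈ F.1, ∀ x ∈ N, ∃ w ∈ star r B, op x (z f) = some w := fun f hf x hx =>
      Set.mem_iInter₂.1 (hz f hf).2 x hx
    let Q : Set S := {w | ∃ f ∈ F.1, ∃ x ∈ N, op x (z f) = some w}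
    have hQ : Q.Finite := by
      have : (⋃ f ∈ F.1, ⋃ x ∈ N, {w | op x (z f) = some w}).Finite := by
        refine F.1.finite_toSet.biUnion fun f _ => hN.biUnion fun x _ => ?_
        refine Set.Subsingleton.finite fun w hw w' hw' => ?_
        exact Option.some.inj (hw.symm.trans hw')
      refine this.subset ?_
      rintro w ⟨f, hf, x, hx, h⟩
      exact Set.mem_biUnion hf (Set.mem_biUnion hx h)
    -- The image of `z` accounts for chains consisting of `F` alone, `Q` for longer ones.
    refine ⟨⟨a, H, z '' (F.1 : Set (AdequateSeq S)) ∪ Q, (F.1.finite_toSet.image z).union hQ, ?_⟩,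
      fun G hG => ?_, fun f hf => ⟨z f, Or.inl ⟨f, hf, rfl⟩, e f hf, fun G hG x hx => ?_⟩⟩
    · rintro w (⟨f, hf, rfl⟩ | ⟨f, hf, x, hx, h⟩)
      · exact (hz f hf).1
      · obtain ⟨w', hw', h'⟩ := hz' f hf x hx
        obtain rfl : w = w' := Option.some.inj (h.symm.trans h')
        exact hw'
    · exact (hm ⟨⟨G, hG⟩, rfl⟩).trans_lt (hH _ (Finset.min'_mem _ _))
    · have hxN : x ∈ N := Set.mem_iUnion.2 ⟨⟨G, hG⟩, hx⟩
      obtain ⟨w, -, h⟩ := hz' f hf x hxN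
      exact ⟨w, Or.inr ⟨f, hf, x, hxN, h⟩, h⟩)
  refine ⟨fun F => (Φ F).1, fun F => (Φ F).2.1, fun F G hFG => (hΦ G).1 F hFG, ?_⟩
  -- Induction on length needs the product in the finite set stored at the last term, not merely in
  -- `B`.
  have key : ∀ (m : ℕ) (G : Fin (m + 1) → FinPow (AdequateSeq S))
      (f : Fin (m + 1) → AdequateSeq S),
      (∀ i j, i < j → (G i).1 ⊂ (G j).1) → (∀ i, f i ∈ (G i).1) →
      ∃ x ∈ (Φ (G (Fin.last m))).2.2.1, listProd (List.ofFn fun i =>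
        optMul (some (Φ (G i)).1) (finProd (f i).1 (Φ (G i)).2.1.1)) = some x := by
    intro m
    induction m with
    | zero =>
      intro G f _ hf
      obtain ⟨z, hz, e, -⟩ := (hΦ (G 0)).2 (f 0) (hf 0)
      exact ⟨z, hz, by simpa [listProd] using e⟩
    | succ m ih =>
      intro G f hG hf
      obtain ⟨x, hx, ex⟩ := ih (fun i => G i.castSucc) (fun i => f i.castSucc)
        (fun i j hij => hG _ _ (Fin.castSucc_lt_castSucc_iff.2 hij)) (fun i => hf _)
      obtain ⟨z, -, ez, h⟩ := (hΦ (G (Fin.last (m + 1)))).2 _ (hf (Fin.last (m + 1)))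
      obtain ⟨w, hw, ew⟩ := h _ (hG _ _ (Fin.castSucc_lt_last (Fin.last m))) x hx
      refine ⟨w, hw, ?_⟩
      rw [List.ofFn_succ', List.concat_eq_append, listProd_append_singleton _ (by simp), ex, ez]
      exact ew
  intro m hm G f hG hf
  obtain ⟨m, rfl⟩ := Nat.exists_eq_add_of_le' hm
  obtain ⟨x, hx, e⟩ := key m G f hG hf
  exact ⟨x, ((Φ _).2.2.2.2 hx).1, e⟩

end CSet

end PartialSemigroup

theorem corollary5p8 {S : Type u} {T : Type v} [PartialSemigroup S] [PartialSemigroup T]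
    (hSc : PartialSemigroup.IsCommutative S) (hSa : PartialSemigroup.IsAdequate S)
    (hTc : PartialSemigroup.IsCommutative T) (hTa : PartialSemigroup.IsAdequate T)
    (h : S → T) (hhom : PartialSemigroup.IsPartialHom h) (hsurj : Function.Surjective h)
    (hdelta : PartialSemigroup.betaExtend h '' PartialSemigroup.delta S =
      PartialSemigroup.delta T)
    (A : Set T) (hA : ¬ PartialSemigroup.IsCentral A)
    (hp : ∃ p : PartialSemigroup.delta T, IsIdempotentElem p ∧ A ∈ p.1 ∧
      p.1 ∈ PartialSemigroup.betaExtend h '' PartialSemigroup.Jdelta S) :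
    PartialSemigroup.IsCSet (h ⁻¹' A) ∧ ¬ PartialSemigroup.IsCentral (h ⁻¹' A) := by
  obtain ⟨p, hpp, hAp, hpJ⟩ := hp
  constructor
  · obtain ⟨r, hr, hrJ, hrp⟩ :=
      PartialSemigroup.exists_isIdempotentElem_of_fiber hSc hhom hpp hpJ
    refine PartialSemigroup.isCSet_of_mem_idempotent hr hrJ ?_
    rwa [← PartialSemigroup.mem_betaExtend, hrp]
  · rintro ⟨r, hr, hrK, hAr⟩
    have hmaps : Set.MapsTo (PartialSemigroup.betaExtend h) (PartialSemigroup.delta S)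
        (PartialSemigroup.delta T) := Set.mapsTo_iff_image_subset.2 hdelta.subset
    let g := hhom.deltaMap hmaps
    have hg : Function.Surjective g := by
      rintro ⟨q, hq⟩
      obtain ⟨s, hs, e⟩ := hdelta.superset hq
      exact ⟨⟨s, hs⟩, Subtype.ext e⟩
    exact hA ⟨g r, hr.map g, PartialSemigroup.map_mem_smallestIdeal g hg hrK,
      (PartialSemigroup.mem_betaExtend h r.1 A).2 hAr⟩
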